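/- **Setting.** Let $f:\mathbb{R}^n\times\mathbb{R}^m\to\mathbb{R}^n$, let $L_1,\dots,L_q$ be linear functionals on $\mathbb{R}^{n+m}$ such that $\mathcal{Z}=\{z\in\mathbb{R}^{n+m}\mid L_jz\le 1,\ j=1,\dots,q\}$ is compact, let $\mathcal{Z}_r\subseteq\mathrm{int}(\mathcal{Z})$, let $Q,R$ be symmetric positive definite, and let $N\ge 1$. Consider $x(t+1)=f(x(t),u(t))+w(t)$ with $\|w(t)\|\le\hat w$. Write $r=(x_r,u_r)$, $\|x\|_Q^2=x^\top Qx$, $\ell(x,u,r)=\|x-x_r\|_Q^2+\|u-u_r\|_R^2$ and $\mathcal{R}(r)=\{(x_r^+,u_r^+)\in\mathcal{Z}_r\mid x_r^+=f(x_r,u_r)\}$. **Incremental stabilizability.** There are $\kappa:\mathbb{R}^n\times\mathcal{Z}\to\mathbb{R}^m$, $V_\delta:\mathbb{R}^n\times\mathcal{Z}\to\mathbb{R}_{\ge0}$, continuous in its first argument and with $V_\delta(x_r,r)=0$ for all $r=(x_r,u_r)\in\mathcal{Z}$, and constants $c_{\delta,l},c_{\delta,u},\delta_{\mathrm{loc}},c_1,\dots,c_q>0$,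 $\rho\in(0,1)$ such that for all $x\in\mathbb{R}^n$, $r=(x_r,u_r)\in\mathcal{Z}$ and $r^+=(f(x_r,u_r),u_r^+)\in\mathcal{Z}$ with $V_\delta(x,r)\le\delta_{\mathrm{loc}}$: $$c_{\delta,l}\|x-x_r\|^2\le V_\delta(x,r)\le c_{\delta,u}\|x-x_r\|^2,$$ $$L_j(x-x_r,\kappa(x,r)-u_r)\le c_j\sqrt{V_\delta(x,r)}\quad(j=1,\dots,q),$$ $$V_\delta(f(x,\kappa(x,r)),r^+)\le\rho^2V_\delta(x,r).$$ **Tightened constraints.** Let $\mathcal{Z}_k=\{z\mid L_jz\le 1-\epsilon_{j,k},\ j=1,\dots,q\}$ with $\epsilon_{j,k}=\frac{1-\rho^k}{1-\rho}\,c_j\sqrt{c_{\delta,u}}\,\hat w$. **Robust terminal ingredients.** There are matrices $K_f(r)\in\mathbb{R}^{m\times n}$ and symmetric $P_f(r)\in\mathbb{R}^{n\times n}$, constants $c_l,c_u,\alpha_w>0$ with $c_lI\le P_f(r)\le c_uI$ for $r\in\mathcal{Z}_r$, such that, with $V_f(x,r)=\|x-x_r\|_{P_f(r)}^2$, $\mathcal{X}_f(r)=\{x\mid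 V_f(x,r)\le\alpha_w\}$, $k_f(x,r)=u_r+K_f(r)(x-x_r)$ and $x^+=f(x,k_f(x,r))$, for all $r\in\mathcal{Z}_r$, $x\in\mathcal{X}_f(r)$, $r^+\in\mathcal{R}(r)$ and all $w$ with $\|w\|\le\hat w\rho^N\sqrt{c_{\delta,u}/c_{\delta,l}}$: $$V_f(x^+,r^+)\le V_f(x,r)-\ell(x,k_f(x,r),r),\qquad V_f(x^++w,r^+)\le\alpha_w,\qquad (x,k_f(x,r))\in\mathcal{Z}_N.$$ **MPC problem.** At time $t$ and state $x(t)$, minimize $\sum_{k=0}^{N-1}\ell(x(k|t),u(k|t),r(t+k))+V_f(x(N|t),r(t+N))$ over $u(0|t),\dots,u(N-1|t)$, subject to $x(0|t)=x(t)$, $x(k+1|t)=f(x(k|t),u(k|t))$, $(x(k|t),u(k|t))\in\mathcal{Z}_k$ for $0\le k\le N-1$, and $x(N|t)\in\mathcal{X}_f(r(t+N))$. The closed loop is $x(t+1)=f(x(t),u^*(0|t))+w(t)$, where $u^*(\cdot|t)$ is any minimizer. **Theorem.** Let incremental stabilizability hold and fix $K_f,P_f,c_l,c_u,\alpha_w$.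 There are constants $C>0$, $\lambda\in(0,1)$, $\gamma\ge0$ such that the following holds for every $\hat w$ with $0\le\hat w\le\sqrt{\delta_{\mathrm{loc}}/c_{\delta,u}}$ for which $K_f,P_f,c_l,c_u,\alpha_w$ are robust terminal ingredients, every reference $r(\cdot)$ with $r(t)\in\mathcal{Z}_r$ and $r(t+1)\in\mathcal{R}(r(t))$ for all $t\ge0$, and every closed-loop trajectory with $\|w(t)\|\le\hat w$ for all $t\ge 0$: if the MPC problem is feasible at $t=0$, then it is feasible for all $t\ge0$ (recursive feasibility), and the tracking error is uniformly practically exponentially stable, i.e. for all $t,k\ge0$ $$\|x(t+k)-x_r(t+k)\|\le C\lambda^k\|x(t)-x_r(t)\|+\gamma\hat w.$$ -/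

import Mathlib

open scoped Matrix

namespace RobustMPC

/-- State space `ℝⁿ` with the Euclidean norm. -/
abbrev State (n : ℕ) := EuclideanSpace ℝ (Fin n)

/-- Input space `ℝᵐ` with the Euclidean norm. -/
abbrev Input (m : ℕ) := EuclideanSpace ℝ (Fin m)

/-- State-input pairs `(x, u)`; also the values `r = (x_r, u_r)` of a reference. -/
abbrev Pair (n m : ℕ) := State n × Input m

/-- The squared weighted norm `‖x‖_Q² = xᵀ Q x`. -/
def quadNorm {d : ℕ} (Q : Matrix (Fin d) (Fin d) ℝ) (x : EuclideanSpace ℝ (Fin d)) : ℝ :=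
  x.ofLp ⬝ᵥ (Q *ᵥ x.ofLp)

/-- The stage cost `ℓ(x, u, r) = ‖x - x_r‖_Q² + ‖u - u_r‖_R²`. -/
def stageCost {n m : ℕ} (Q : Matrix (Fin n) (Fin n) ℝ) (R : Matrix (Fin m) (Fin m) ℝ)
    (x : State n) (u : Input m) (r : Pair n m) : ℝ :=
  quadNorm Q (x - r.1) + quadNorm R (u - r.2)

/-- The constraint set `Z = {z | L_j z ≤ 1, j = 1, …, q}`. -/
def constraintSet {n m q : ℕ} (L : Fin q → Pair n m →ₗ[ℝ] ℝ) : Set (Pair n m) :=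
  {z | ∀ j, L j z ≤ 1}

/-- The admissible successors `𝓡(r) = {(x_r⁺, u_r⁺) ∈ Z_r | x_r⁺ = f(x_r, u_r)}`. -/
def successors {n m : ℕ} (f : State n → Input m → State n) (Zr : Set (Pair n m))
    (r : Pair n m) : Set (Pair n m) :=
  {r' | r' ∈ Zr ∧ r'.1 = f r.1 r.2}

/-- Reachable reference signals: `r(t) ∈ Z_r` and `r(t+1) ∈ 𝓡(r(t))` for all `t ≥ 0`. -/
def IsReference {n m : ℕ} (f : State n → Input m → State n) (Zr : Set (Pair n m))
    (r : ℕ → Pair n m) : Prop :=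
  ∀ t, r t ∈ Zr ∧ r (t + 1) ∈ successors f Zr (r t)

/-- The control law, incremental Lyapunov function and constants that enter incremental
stabilizability. -/
structure IncrementalData (n m q : ℕ) where
  /-- control law `κ(x, r)` -/
  kappa : State n → Pair n m → Input m
  /-- incremental Lyapunov function `V_δ(x, r)` -/
  V : State n → Pair n m → ℝ
  /-- `c_{δ,l}` -/
  cl : ℝ
  /-- `c_{δ,u}` -/
  cu : ℝ
  /-- `δ_loc` -/
  deltaLoc : ℝ
  /-- `c_j` -/
  c : Fin q → ℝ
  /-- contraction rate `ρ` -/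
  rho : ℝ

/-- The (local) incremental stabilizability property. Only the values of `κ` and `V_δ` at points
`(x, r)` with `r ∈ Z` matter. -/
structure IncrementallyStabilizable {n m q : ℕ} (f : State n → Input m → State n)
    (L : Fin q → Pair n m →ₗ[ℝ] ℝ) (D : IncrementalData n m q) : Prop where
  cl_pos : 0 < D.cl
  cu_pos : 0 < D.cu
  deltaLoc_pos : 0 < D.deltaLoc
  c_pos : ∀ j, 0 < D.c j
  rho_mem : D.rho ∈ Set.Ioo (0 : ℝ) 1
  V_nonneg : ∀ x, ∀ r ∈ constraintSet L, 0 ≤ D.V x r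
  V_continuous : ∀ r ∈ constraintSet L, Continuous fun x => D.V x r
  V_self : ∀ r ∈ constraintSet L, D.V r.1 r = 0
  local_bounds : ∀ x, ∀ r ∈ constraintSet L, ∀ r' ∈ constraintSet L, r'.1 = f r.1 r.2 →
    D.V x r ≤ D.deltaLoc →
      (D.cl * ‖x - r.1‖ ^ 2 ≤ D.V x r ∧ D.V x r ≤ D.cu * ‖x - r.1‖ ^ 2) ∧
      (∀ j, L j (x - r.1, D.kappa x r - r.2) ≤ D.c j * √(D.V x r)) ∧
      D.V (f x (D.kappa x r)) r' ≤ D.rho ^ 2 * D.V x r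

/-- The tightening `ε_{j,k} = (1 - ρᵏ)/(1 - ρ) · ε_j` with `ε_j = c_j √c_{δ,u} ŵ`. -/
noncomputable def tightening {n m q : ℕ} (D : IncrementalData n m q) (what : ℝ)
    (j : Fin q) (k : ℕ) : ℝ :=
  (1 - D.rho ^ k) / (1 - D.rho) * (D.c j * √D.cu * what)

/-- The tightened constraint set `Z_k = {z | L_j z ≤ 1 - ε_{j,k}, j = 1, …, q}`. -/
def tightenedSet {n m q : ℕ} (L : Fin q → Pair n m →ₗ[ℝ] ℝ) (D : IncrementalData n m q)
    (what : ℝ) (k : ℕ) : Set (Pair n m) :=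
  {z | ∀ j, L j z ≤ 1 - tightening D what j k}

/-- The reference-dependent terminal matrices and the constants of the terminal ingredients. -/
structure TerminalData (n m : ℕ) where
  /-- terminal feedback `K_f(r)` -/
  K : Pair n m → Matrix (Fin m) (Fin n) ℝ
  /-- terminal weight `P_f(r)` -/
  P : Pair n m → Matrix (Fin n) (Fin n) ℝ
  /-- `c_l` -/
  cl : ℝ
  /-- `c_u` -/
  cu : ℝ
  /-- terminal set size `α_w` -/
  alpha : ℝ

/-- The terminal cost `V_f(x, r) = ‖x - x_r‖²_{P_f(r)}`. -/
def TerminalData.Vf {n m : ℕ} (T : TerminalData n m) (x : State n) (r : Pair n m) : ℝ :=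
  quadNorm (T.P r) (x - r.1)

/-- The terminal controller `k_f(x, r) = u_r + K_f(r) (x - x_r)`. -/
noncomputable def TerminalData.kf {n m : ℕ} (T : TerminalData n m) (x : State n)
    (r : Pair n m) : Input m :=
  r.2 + WithLp.toLp 2 (T.K r *ᵥ (x - r.1).ofLp)

/-- The terminal set `𝓧_f(r) = {x | V_f(x, r) ≤ α_w}`. -/
def TerminalData.Xf {n m : ℕ} (T : TerminalData n m) (r : Pair n m) : Set (State n) :=
  {x | T.Vf x r ≤ T.alpha}

/-- The robust terminal ingredients for horizon `N` and disturbance bound `ŵ`. The matrix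
inequalities `c_l I ≤ P_f(r) ≤ c_u I` are between symmetric matrices. The bound in `rpi` is
`ŵ_N = ŵ ρᴺ √(c_{δ,u}/c_{δ,l})`. -/
structure RobustTerminal {n m q : ℕ} (f : State n → Input m → State n)
    (L : Fin q → Pair n m →ₗ[ℝ] ℝ) (Zr : Set (Pair n m))
    (Q : Matrix (Fin n) (Fin n) ℝ) (R : Matrix (Fin m) (Fin m) ℝ) (N : ℕ)
    (D : IncrementalData n m q) (T : TerminalData n m) (what : ℝ) : Prop where
  cl_pos : 0 < T.cl
  cu_pos : 0 < T.cu
  alpha_pos : 0 < T.alpha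
  P_lower : ∀ r ∈ Zr, (T.P r - T.cl • (1 : Matrix (Fin n) (Fin n) ℝ)).PosSemidef
  P_upper : ∀ r ∈ Zr, (T.cu • (1 : Matrix (Fin n) (Fin n) ℝ) - T.P r).PosSemidef
  decrease : ∀ r ∈ Zr, ∀ x ∈ T.Xf r, ∀ r' ∈ successors f Zr r,
    T.Vf (f x (T.kf x r)) r' ≤ T.Vf x r - stageCost Q R x (T.kf x r) r
  rpi : ∀ r ∈ Zr, ∀ x ∈ T.Xf r, ∀ r' ∈ successors f Zr r,
    ∀ w : State n, ‖w‖ ≤ what * D.rho ^ N * √(D.cu / D.cl) →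
      T.Vf (f x (T.kf x r) + w) r' ≤ T.alpha
  con : ∀ r ∈ Zr, ∀ x ∈ T.Xf r, ∀ r' ∈ successors f Zr r,
    (x, T.kf x r) ∈ tightenedSet L D what N

/-- The predicted (undisturbed) states: `x(0|t) = x`, `x(k+1|t) = f(x(k|t), u(k|t))`. -/
def predict {n m : ℕ} (f : State n → Input m → State n) (x : State n) (u : ℕ → Input m) :
    ℕ → State n
  | 0 => x
  | k + 1 => f (predict f x u k) (u k)

/-- The open-loop cost `J_N` of the input sequence `u(0|t), …, u(N-1|t)` from state `x` at time
`t`. Entries `u k` with `k ≥ N` play no role here nor in the constraints. -/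
def cost {n m : ℕ} (f : State n → Input m → State n)
    (Q : Matrix (Fin n) (Fin n) ℝ) (R : Matrix (Fin m) (Fin m) ℝ) (N : ℕ)
    (T : TerminalData n m) (r : ℕ → Pair n m) (t : ℕ) (x : State n) (u : ℕ → Input m) : ℝ :=
  ∑ k ∈ Finset.range N, stageCost Q R (predict f x u k) (u k) (r (t + k)) +
    T.Vf (predict f x u N) (r (t + N))

/-- `u` satisfies the constraints of the robust MPC problem at time `t` in state `x`. -/
def FeasibleInput {n m q : ℕ} (f : State n → Input m → State n)
    (L : Fin q → Pair n m →ₗ[ℝ] ℝ) (N : ℕ) (D : IncrementalData n m q) (T : TerminalData n m)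
    (what : ℝ) (r : ℕ → Pair n m) (t : ℕ) (x : State n) (u : ℕ → Input m) : Prop :=
  (∀ k < N, (predict f x u k, u k) ∈ tightenedSet L D what k) ∧
    predict f x u N ∈ T.Xf (r (t + N))

/-- The robust MPC problem at time `t` in state `x` is feasible. -/
def Feasible {n m q : ℕ} (f : State n → Input m → State n)
    (L : Fin q → Pair n m →ₗ[ℝ] ℝ) (N : ℕ) (D : IncrementalData n m q) (T : TerminalData n m)
    (what : ℝ) (r : ℕ → Pair n m) (t : ℕ) (x : State n) : Prop :=
  ∃ u, FeasibleInput f L N D T what r t x u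

/-- `u` solves the robust MPC problem at time `t` in state `x`. -/
def IsOptimal {n m q : ℕ} (f : State n → Input m → State n)
    (L : Fin q → Pair n m →ₗ[ℝ] ℝ) (Q : Matrix (Fin n) (Fin n) ℝ)
    (R : Matrix (Fin m) (Fin m) ℝ) (N : ℕ) (D : IncrementalData n m q) (T : TerminalData n m)
    (what : ℝ) (r : ℕ → Pair n m) (t : ℕ) (x : State n) (u : ℕ → Input m) : Prop :=
  FeasibleInput f L N D T what r t x u ∧
    ∀ v, FeasibleInput f L N D T what r t x v →
      cost f Q R N T r t x u ≤ cost f Q R N T r t x v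

/-- `x` is a trajectory of the closed loop `x(t+1) = f(x(t), u*(0|t)) + w(t)`, `‖w(t)‖ ≤ ŵ`,
where `ustar t` is an optimal input sequence at time `t` whenever the problem at time `t` is
feasible. Feasibility itself is not part of this definition. -/
def ClosedLoop {n m q : ℕ} (f : State n → Input m → State n)
    (L : Fin q → Pair n m →ₗ[ℝ] ℝ) (Q : Matrix (Fin n) (Fin n) ℝ)
    (R : Matrix (Fin m) (Fin m) ℝ) (N : ℕ) (D : IncrementalData n m q) (T : TerminalData n m)
    (what : ℝ) (r : ℕ → Pair n m)
    (x : ℕ → State n) (ustar : ℕ → ℕ → Input m) (w : ℕ → State n) : Prop :=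
  ∀ t, ‖w t‖ ≤ what ∧
    (Feasible f L N D T what r t (x t) → IsOptimal f L Q R N D T what r t (x t) (ustar t)) ∧
    x (t + 1) = f (x t) (ustar t 0) + w t

end RobustMPC

open RobustMPC

/-!
The proof is the Lyapunov argument for robust MPC with growing constraint tightening.

*Recursive feasibility.* Extend the optimal prediction at time `t` by the terminal controller. At
time `t + 1` the measured state is `ŵ`-close to this extended trajectory, and the incremental
controller `κ`, with the extended trajectory as its reference, gives a candidate input
(`exists_tracking_input`). Its deviation from the reference decays like `ρᵏ ŵ`, both in norm and in
each constraint functional `L_j`. Since `ε_{j,k+1} - ε_{j,k} = ρᵏ c_j √c_{δ,u} ŵ`, the shift by one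
step frees exactly this margin in the constraints, and the robust invariance of the terminal set
absorbs the deviation at the end of the horizon (`exists_candidate`).

*Stability.* The optimal cost `J` satisfies `p ‖e‖² ≤ J ≤ a ‖e‖²` in the tracking error `e`. The
upper bound comes from the terminal controller inside the terminal set and from boundedness of `Z`
outside (`IsOptimal.cost_le`). Neither `κ` nor `f` is assumed continuous, but `Z` is bounded, so
the functionals `L_j` jointly control the deviation of the candidate in state and input
(`norm_le_of_forall_le`). Young's inequality for quadratic forms (`quadNorm_add_le`) then gives
`J (t+1) ≤ (1 + η) (J t - ℓ) + O(ŵ²)`. As `ℓ ≥ θ J t` for a fixed `θ > 0`, a small `η` makes this a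
contraction up to `O(ŵ²)`, and square roots give a gain linear in `ŵ`.
-/

namespace RobustMPC

/-! ### Weighted quadratic forms -/

lemma quadNorm_smul {d : ℕ} (M : Matrix (Fin d) (Fin d) ℝ) (c : ℝ)
    (x : EuclideanSpace ℝ (Fin d)) : quadNorm M (c • x) = c ^ 2 * quadNorm M x := by
  simp only [quadNorm, WithLp.ofLp_smul, Matrix.mulVec_smul, smul_dotProduct, dotProduct_smul,
    smul_eq_mul]
  ring

lemma quadNorm_one {d : ℕ} (x : EuclideanSpace ℝ (Fin d)) :
    quadNorm (1 : Matrix (Fin d) (Fin d) ℝ) x = ‖x‖ ^ 2 := by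
  rw [EuclideanSpace.real_norm_sq_eq]
  simp [quadNorm, dotProduct, pow_two]

lemma continuous_quadNorm {d : ℕ} (M : Matrix (Fin d) (Fin d) ℝ) : Continuous (quadNorm M) := by
  unfold quadNorm
  fun_prop

lemma quadNorm_nonneg {d : ℕ} {M : Matrix (Fin d) (Fin d) ℝ} (hM : M.PosSemidef)
    (x : EuclideanSpace ℝ (Fin d)) : 0 ≤ quadNorm M x := by
  simpa [quadNorm] using hM.dotProduct_mulVec_nonneg x.ofLp

lemma mul_sq_norm_le_quadNorm {d : ℕ} {M : Matrix (Fin d) (Fin d) ℝ} {c : ℝ}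
    (hM : (M - c • (1 : Matrix (Fin d) (Fin d) ℝ)).PosSemidef) (x : EuclideanSpace ℝ (Fin d)) :
    c * ‖x‖ ^ 2 ≤ quadNorm M x := by
  have h := quadNorm_nonneg hM x
  have e : quadNorm (M - c • (1 : Matrix (Fin d) (Fin d) ℝ)) x = quadNorm M x - c * ‖x‖ ^ 2 := by
    rw [← quadNorm_one x]
    simp only [quadNorm, Matrix.sub_mulVec, Matrix.smul_mulVec, dotProduct_sub, dotProduct_smul,
      smul_eq_mul]
  linarith

lemma quadNorm_le_mul_sq_norm {d : ℕ} {M : Matrix (Fin d) (Fin d) ℝ} {c : ℝ}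
    (hM : (c • (1 : Matrix (Fin d) (Fin d) ℝ) - M).PosSemidef) (x : EuclideanSpace ℝ (Fin d)) :
    quadNorm M x ≤ c * ‖x‖ ^ 2 := by
  have h := quadNorm_nonneg hM x
  have e : quadNorm (c • (1 : Matrix (Fin d) (Fin d) ℝ) - M) x = c * ‖x‖ ^ 2 - quadNorm M x := by
    rw [← quadNorm_one x]
    simp only [quadNorm, Matrix.sub_mulVec, Matrix.smul_mulVec, dotProduct_sub, dotProduct_smul,
      smul_eq_mul]
  linarith

/-- Young's inequality for a nonnegative quadratic form; the gap is `η⁻¹ ‖η a - b‖_M²`. -/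
lemma quadNorm_add_le {d : ℕ} {M : Matrix (Fin d) (Fin d) ℝ} (hM : ∀ x, 0 ≤ quadNorm M x)
    {η : ℝ} (hη : 0 < η) (a b : EuclideanSpace ℝ (Fin d)) :
    quadNorm M (a + b) ≤ (1 + η) * quadNorm M a + (1 + η⁻¹) * quadNorm M b := by
  have h : 0 ≤ η⁻¹ * quadNorm M (η • a - b) := mul_nonneg (inv_pos.2 hη).le (hM _)
  have e : η⁻¹ * quadNorm M (η • a - b) + quadNorm M (a + b)
      = (1 + η) * quadNorm M a + (1 + η⁻¹) * quadNorm M b := by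
    simp only [quadNorm, WithLp.ofLp_smul, WithLp.ofLp_add, WithLp.ofLp_sub, Matrix.mulVec_smul,
      Matrix.mulVec_add, Matrix.mulVec_sub, smul_dotProduct, dotProduct_smul, add_dotProduct,
      dotProduct_add, sub_dotProduct, dotProduct_sub, smul_eq_mul]
    field_simp
    ring
  linarith

/-- Comparing a quadratic form with `‖x‖²` reduces to the unit sphere. -/
lemma quadNorm_homogeneous {d : ℕ} (M : Matrix (Fin d) (Fin d) ℝ)
    {x : EuclideanSpace ℝ (Fin d)} (hx : x ≠ 0) :
    ‖x‖⁻¹ • x ∈ Metric.sphere (0 : EuclideanSpace ℝ (Fin d)) 1 ∧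
      quadNorm M x = quadNorm M (‖x‖⁻¹ • x) * ‖x‖ ^ 2 := by
  have h : ‖x‖ ≠ 0 := norm_ne_zero_iff.2 hx
  constructor
  · simp [norm_smul, h]
  · rw [quadNorm_smul]
    field_simp

lemma exists_quadNorm_le {d : ℕ} (M : Matrix (Fin d) (Fin d) ℝ) :
    ∃ c, 0 ≤ c ∧ ∀ x, quadNorm M x ≤ c * ‖x‖ ^ 2 := by
  obtain ⟨c, hc⟩ := (isCompact_sphere (0 : EuclideanSpace ℝ (Fin d)) 1).exists_bound_of_continuousOn
    (continuous_quadNorm M).continuousOn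
  refine ⟨|c|, abs_nonneg c, fun x => ?_⟩
  by_cases hx : x = 0
  · simp [hx, quadNorm]
  · obtain ⟨h1, h2⟩ := quadNorm_homogeneous M hx
    rw [h2]
    gcongr
    exact (le_abs_self _).trans ((hc _ h1).trans (le_abs_self c))

lemma exists_le_quadNorm {d : ℕ} {M : Matrix (Fin d) (Fin d) ℝ} (hM : M.PosDef) :
    ∃ c, 0 < c ∧ ∀ x, c * ‖x‖ ^ 2 ≤ quadNorm M x := by
  obtain hS | hS := (Metric.sphere (0 : EuclideanSpace ℝ (Fin d)) 1).eq_empty_or_nonempty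
  · refine ⟨1, one_pos, fun x => ?_⟩
    by_cases hx : x = 0
    · simp [hx, quadNorm]
    · exact absurd (quadNorm_homogeneous M hx).1 (by simp [hS])
  · obtain ⟨s, hs, hmin⟩ := (isCompact_sphere (0 : EuclideanSpace ℝ (Fin d)) 1).exists_isMinOn hS
      (continuous_quadNorm M).continuousOn
    have hs0 : s.ofLp ≠ 0 := by
      intro h
      have : s = 0 := by ext i; simp [h]
      simp [this] at hs
    refine ⟨quadNorm M s, by simpa [quadNorm] using hM.dotProduct_mulVec_pos hs0, fun x => ?_⟩
    by_cases hx : x = 0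
    · simp [hx, quadNorm]
    · obtain ⟨h1, h2⟩ := quadNorm_homogeneous M hx
      rw [h2]
      gcongr
      exact hmin h1

/-! ### Stage costs -/

section StageCost

variable {n m : ℕ} {Q : Matrix (Fin n) (Fin n) ℝ} {R : Matrix (Fin m) (Fin m) ℝ}

lemma stageCost_nonneg (hQ : Q.PosSemidef) (hR : R.PosSemidef) (x : State n) (u : Input m)
    (r : Pair n m) : 0 ≤ stageCost Q R x u r :=
  add_nonneg (quadNorm_nonneg hQ _) (quadNorm_nonneg hR _)

lemma stageCost_le {cQ cR s : ℝ} (hcQ : 0 ≤ cQ) (hcR : 0 ≤ cR)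
    (hQ : ∀ x, quadNorm Q x ≤ cQ * ‖x‖ ^ 2) (hR : ∀ x, quadNorm R x ≤ cR * ‖x‖ ^ 2)
    {z r : Pair n m} (h : ‖z - r‖ ≤ s) : stageCost Q R z.1 z.2 r ≤ (cQ + cR) * s ^ 2 := by
  have h1 : ‖z.1 - r.1‖ ≤ s := (norm_fst_le (z - r)).trans h
  have h2 : ‖z.2 - r.2‖ ≤ s := (norm_snd_le (z - r)).trans h
  calc stageCost Q R z.1 z.2 r ≤ cQ * ‖z.1 - r.1‖ ^ 2 + cR * ‖z.2 - r.2‖ ^ 2 :=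
        add_le_add (hQ _) (hR _)
    _ ≤ cQ * s ^ 2 + cR * s ^ 2 := by gcongr
    _ = (cQ + cR) * s ^ 2 := by ring

lemma stageCost_le_of_near (hQ : Q.PosSemidef) (hR : R.PosSemidef) {η : ℝ} (hη : 0 < η)
    (z z' r : Pair n m) :
    stageCost Q R z.1 z.2 r ≤
      (1 + η) * stageCost Q R z'.1 z'.2 r + (1 + η⁻¹) * stageCost Q R z.1 z.2 z' := by
  have h1 := quadNorm_add_le (quadNorm_nonneg hQ) hη (z'.1 - r.1) (z.1 - z'.1)
  have h2 := quadNorm_add_le (quadNorm_nonneg hR) hη (z'.2 - r.2) (z.2 - z'.2)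
  rw [show z'.1 - r.1 + (z.1 - z'.1) = z.1 - r.1 by abel] at h1
  rw [show z'.2 - r.2 + (z.2 - z'.2) = z.2 - r.2 by abel] at h2
  simp only [stageCost]
  linarith

end StageCost

/-! ### Constraint sets -/

section Constraints

variable {n m q : ℕ} {L : Fin q → Pair n m →ₗ[ℝ] ℝ}

/-- A bounded polytope `{z | L_j z ≤ 1}` has trivial recession cone, so that the `L_j` jointly
control the norm: `z / s` lies in the polytope. -/
lemma norm_le_of_forall_le {M : ℝ} (hM : ∀ z ∈ constraintSet L, ‖z‖ ≤ M) {s : ℝ} (hs : 0 ≤ s)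
    {z : Pair n m} (h : ∀ j, L j z ≤ s) : ‖z‖ ≤ M * s := by
  -- The bound is proved for every `s' > s`, which covers `s = 0`.
  have key : ∀ s' : ℝ, s < s' → ‖z‖ ≤ M * s' := by
    intro s' hs'
    have h0 : 0 < s' := hs.trans_lt hs'
    have hz : s'⁻¹ • z ∈ constraintSet L := by
      intro j
      rw [map_smul, smul_eq_mul, inv_mul_le_iff₀ h0, mul_one]
      exact (h j).trans hs'.le
    have := hM _ hz
    rw [norm_smul, norm_inv, Real.norm_of_nonneg h0.le, inv_mul_le_iff₀ h0] at this
    linarith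
  have hc : Filter.Tendsto (fun s' : ℝ => M * s') (nhdsWithin s (Set.Ioi s)) (nhds (M * s)) :=
    ((continuous_const_mul M).tendsto s).mono_left nhdsWithin_le_nhds
  exact ge_of_tendsto hc (Filter.eventually_of_mem self_mem_nhdsWithin key)

variable {f : State n → Input m → State n} {D : IncrementalData n m q} {what : ℝ}

/-- `ε_{j,k}` is the geometric sum of the disturbance effects accumulated over `k` steps. -/
lemma tightening_succ (hD : IncrementallyStabilizable f L D) (j : Fin q) (k : ℕ) :
    tightening D what j (k + 1) =
      tightening D what j k + D.c j * (D.rho ^ k * (√D.cu * what)) := by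
  have : 1 - D.rho ≠ 0 := by linarith [hD.rho_mem.2]
  simp only [tightening]
  field_simp
  ring

lemma tightening_mono (hD : IncrementallyStabilizable f L D) (hw : 0 ≤ what) (j : Fin q) :
    Monotone (tightening D what j) := by
  refine monotone_nat_of_le_succ fun k => ?_
  rw [tightening_succ hD]
  have := hD.rho_mem.1
  have := hD.c_pos j
  have : 0 ≤ D.c j * (D.rho ^ k * (√D.cu * what)) := by positivity
  linarith

lemma tightenedSet_anti (hD : IncrementallyStabilizable f L D) (hw : 0 ≤ what) :
    Antitone (tightenedSet L D what) := by
  intro a b hab z hz j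
  linarith [hz j, tightening_mono hD hw j hab]

lemma tightenedSet_subset (hD : IncrementallyStabilizable f L D) (hw : 0 ≤ what) (k : ℕ) :
    tightenedSet L D what k ⊆ constraintSet L := by
  intro z hz j
  have h0 : tightening D what j 0 = 0 := by simp [tightening]
  linarith [hz j, tightening_mono hD hw j (Nat.zero_le k)]

end Constraints

/-! ### Tracking of a nominal trajectory by the incremental controller -/

/-- The states generated from `x` by the time-varying state feedback `π`. -/
def rollout {n m : ℕ} (f : State n → Input m → State n) (π : ℕ → State n → Input m)
    (x : State n) : ℕ → State n
  | 0 => x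
  | k + 1 => f (rollout f π x k) (π k (rollout f π x k))

lemma predict_rollout {n m : ℕ} (f : State n → Input m → State n) (π : ℕ → State n → Input m)
    (x : State n) (k : ℕ) :
    predict f x (fun i => π i (rollout f π x i)) k = rollout f π x k := by
  induction k with
  | zero => rfl
  | succ k ih => simp only [predict, rollout, ih]

section Tracking

variable {n m q : ℕ} {f : State n → Input m → State n} {L : Fin q → Pair n m →ₗ[ℝ] ℝ}
  {D : IncrementalData n m q} {what : ℝ}

/-- The quadratic upper bound on `V_δ` is assumed only where `V_δ ≤ δ_loc`. It holds on the ball of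
radius `√(δ_loc / c_{δ,u})`: on the segment from the centre, `V_δ` starts at `0` and cannot
cross the level `δ_loc` before leaving the ball. -/
lemma V_le_of_norm_le (hD : IncrementallyStabilizable f L D) {x : State n} {r r' : Pair n m}
    (hr : r ∈ constraintSet L) (hr' : r' ∈ constraintSet L) (hf : r'.1 = f r.1 r.2)
    (hx : ‖x - r.1‖ ≤ √(D.deltaLoc / D.cu)) :
    D.V x r ≤ D.deltaLoc ∧ D.V x r ≤ D.cu * ‖x - r.1‖ ^ 2 := by
  have hcu := hD.cu_pos
  have hdl := hD.deltaLoc_pos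
  have hsq : D.cu * ‖x - r.1‖ ^ 2 ≤ D.deltaLoc := by
    have h := pow_le_pow_left₀ (norm_nonneg _) hx 2
    rw [Real.sq_sqrt (by positivity), le_div_iff₀ hcu] at h
    linarith
  have key : D.V x r ≤ D.deltaLoc := by
    by_contra! hlt
    have hcont : ContinuousOn (fun s : ℝ => D.V (r.1 + s • (x - r.1)) r) (Set.Icc 0 1) :=
      ((hD.V_continuous r hr).comp (by fun_prop)).continuousOn
    obtain ⟨s, ⟨hs0, hs1⟩, hs⟩ := intermediate_value_Icc (zero_le_one' ℝ) hcont
      (show D.deltaLoc ∈ _ by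
        simp only [zero_smul, add_zero, one_smul, add_sub_cancel, hD.V_self r hr]
        exact ⟨hdl.le, hlt.le⟩)
    simp only at hs
    have hb := ((hD.local_bounds _ r hr r' hr' hf hs.le).1).2
    rw [hs, add_sub_cancel_left, norm_smul, mul_pow, Real.norm_of_nonneg hs0] at hb
    have hs1' : s ≠ 1 := by
      rintro rfl
      rw [one_smul, add_sub_cancel] at hs
      exact hlt.ne' hs
    have : s < 1 := lt_of_le_of_ne hs1 hs1'
    have : s ^ 2 < 1 := by nlinarith
    nlinarith
  exact ⟨key, ((hD.local_bounds x r hr r' hr' hf key).1).2⟩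

/-- Starting `ŵ`-close to a nominal trajectory `z` in `Z`, the feedback `κ(·, z k)` generates a
trajectory that approaches `z` at rate `ρ`, in norm and in each constraint functional. -/
lemma exists_tracking_input (hD : IncrementallyStabilizable f L D) (hw : 0 ≤ what)
    (hwd : what ≤ √(D.deltaLoc / D.cu)) {z : ℕ → Pair n m} (hz : ∀ k, z k ∈ constraintSet L)
    (hdyn : ∀ k, (z (k + 1)).1 = f (z k).1 (z k).2) {x : State n} (hx : ‖x - (z 0).1‖ ≤ what) :
    ∃ v : ℕ → Input m, ∀ k,
      (∀ j, L j ((predict f x v k, v k) - z k) ≤ D.c j * (D.rho ^ k * (√D.cu * what))) ∧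
      ‖predict f x v k - (z k).1‖ ≤ what * D.rho ^ k * √(D.cu / D.cl) := by
  have hcu := hD.cu_pos
  have hcl := hD.cl_pos
  obtain ⟨hρ0, hρ1⟩ := hD.rho_mem
  set y := rollout f (fun k x => D.kappa x (z k)) x with hy
  have hV : ∀ k, D.V (y k) (z k) ≤ D.deltaLoc ∧
      D.V (y k) (z k) ≤ (D.rho ^ k * (√D.cu * what)) ^ 2 := by
    intro k
    induction k with
    | zero =>
      obtain ⟨h1, h2⟩ := V_le_of_norm_le hD (hz 0) (hz 1) (hdyn 0) (hx.trans hwd)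
      refine ⟨h1, h2.trans ?_⟩
      rw [pow_zero, one_mul, mul_pow, Real.sq_sqrt hcu.le]
      gcongr
    | succ k ih =>
      have h := (hD.local_bounds (y k) _ (hz k) _ (hz (k + 1)) (hdyn k) ih.1).2.2
      have h0 := hD.V_nonneg (y k) _ (hz k)
      have hρ2 : D.rho ^ 2 ≤ 1 := pow_le_one₀ hρ0.le hρ1.le
      refine ⟨h.trans ((mul_le_of_le_one_left h0 hρ2).trans ih.1), h.trans ?_⟩
      calc D.rho ^ 2 * D.V (y k) (z k) ≤ D.rho ^ 2 * (D.rho ^ k * (√D.cu * what)) ^ 2 := by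
            gcongr
            exact ih.2
        _ = _ := by ring
  refine ⟨fun k => D.kappa (y k) (z k), fun k => ?_⟩
  have hp : predict f x (fun k => D.kappa (y k) (z k)) k = y k :=
    predict_rollout f (fun k x => D.kappa x (z k)) x k
  rw [hp]
  obtain ⟨⟨hlow, -⟩, hL, -⟩ := hD.local_bounds (y k) _ (hz k) _ (hz (k + 1)) (hdyn k) (hV k).1
  constructor
  · intro j
    refine (hL j).trans ?_
    have := hD.c_pos j
    gcongr
    exact Real.sqrt_le_iff.2 ⟨by positivity, (hV k).2⟩
  · refine abs_le_of_sq_le_sq' ?_ (by positivity) |>.2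
    rw [mul_pow, mul_pow, Real.sq_sqrt (by positivity)]
    have h := hlow.trans (hV k).2
    rw [mul_pow, mul_pow, Real.sq_sqrt hcu.le] at h
    rw [← mul_div_assoc, le_div_iff₀ hcl]
    linarith

end Tracking

/-! ### The terminal controller as an extension of predicted trajectories -/

section Terminal

variable {n m q : ℕ} {f : State n → Input m → State n} {L : Fin q → Pair n m →ₗ[ℝ] ℝ}
  {Zr : Set (Pair n m)} {Q : Matrix (Fin n) (Fin n) ℝ} {R : Matrix (Fin m) (Fin m) ℝ} {N : ℕ}
  {D : IncrementalData n m q} {T : TerminalData n m} {what : ℝ} {r : ℕ → Pair n m}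

lemma RobustTerminal.quadNorm_P_nonneg (hT : RobustTerminal f L Zr Q R N D T what) {r : Pair n m}
    (hr : r ∈ Zr) (x : State n) : 0 ≤ quadNorm (T.P r) x :=
  (mul_nonneg hT.cl_pos.le (sq_nonneg _)).trans (mul_sq_norm_le_quadNorm (hT.P_lower r hr) x)

lemma RobustTerminal.map_Xf (hT : RobustTerminal f L Zr Q R N D T what) (hw : 0 ≤ what)
    (hρ : 0 ≤ D.rho) {r r' : Pair n m} (hr : r ∈ Zr) (hr' : r' ∈ successors f Zr r) {x : State n}
    (hx : x ∈ T.Xf r) : f x (T.kf x r) ∈ T.Xf r' := by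
  have h := hT.rpi r hr x hx r' hr' 0 (by rw [norm_zero]; positivity)
  rwa [add_zero] at h

/-- A predicted trajectory that reaches the terminal set after `M` steps, continued indefinitely by
the terminal controller. The case `M = 0` is the terminal controller's own trajectory. -/
lemma exists_terminal_extension (hT : RobustTerminal f L Zr Q R N D T what) (hw : 0 ≤ what)
    (hρ : 0 ≤ D.rho) (hr : IsReference f Zr r) {t M : ℕ} {x : State n} {u : ℕ → Input m}
    (h : predict f x u M ∈ T.Xf (r (t + M))) :
    ∃ z : ℕ → Pair n m, (∀ k < M, z k = (predict f x u k, u k)) ∧ (z M).1 = predict f x u M ∧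
      (∀ k, (z (k + 1)).1 = f (z k).1 (z k).2) ∧
      ∀ k, M ≤ k → (z k).1 ∈ T.Xf (r (t + k)) ∧ (z k).2 = T.kf (z k).1 (r (t + k)) := by
  set π : ℕ → State n → Input m := fun k y => if k < M then u k else T.kf y (r (t + k)) with hπ
  have hlt : ∀ k < M, ∀ y, π k y = u k := fun k hk y => if_pos hk
  have hy : ∀ k ≤ M, rollout f π x k = predict f x u k := by
    intro k
    induction k with
    | zero => intro _; rfl
    | succ k ih =>
      intro hk
      rw [rollout, predict, ih (by omega), hlt k hk]
  have hπ' : ∀ k, M ≤ k → ∀ y, π k y = T.kf y (r (t + k)) := fun k hk y => if_neg (by omega)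
  refine ⟨fun k => (rollout f π x k, π k (rollout f π x k)), fun k hk => ?_, hy M le_rfl,
    fun k => rfl, fun k hk => ⟨?_, hπ' k hk _⟩⟩
  · simp only [hy k hk.le, hlt k hk]
  · induction k, hk using Nat.le_induction with
    | base => simpa only [hy M le_rfl] using h
    | succ k hk ih =>
      simp only [rollout, hπ' k hk]
      exact hT.map_Xf hw hρ (hr _).1 (hr _).2 ih

variable {z : ℕ → Pair n m} {t M : ℕ}

lemma terminal_mem_tightenedSet (hT : RobustTerminal f L Zr Q R N D T what)
    (hr : IsReference f Zr r)
    (hz : ∀ k, M ≤ k → (z k).1 ∈ T.Xf (r (t + k)) ∧ (z k).2 = T.kf (z k).1 (r (t + k)))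
    {k : ℕ} (hk : M ≤ k) : z k ∈ tightenedSet L D what N := by
  obtain ⟨h1, h2⟩ := hz k hk
  have h := hT.con _ (hr (t + k)).1 _ h1 _ (hr (t + k)).2
  rwa [← h2] at h

lemma terminal_decrease (hT : RobustTerminal f L Zr Q R N D T what)
    (hr : IsReference f Zr r) (hdyn : ∀ k, (z (k + 1)).1 = f (z k).1 (z k).2)
    (hz : ∀ k, M ≤ k → (z k).1 ∈ T.Xf (r (t + k)) ∧ (z k).2 = T.kf (z k).1 (r (t + k)))
    {k : ℕ} (hk : M ≤ k) :
    stageCost Q R (z k).1 (z k).2 (r (t + k)) + T.Vf (z (k + 1)).1 (r (t + (k + 1))) ≤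
      T.Vf (z k).1 (r (t + k)) := by
  obtain ⟨h1, h2⟩ := hz k hk
  have h := hT.decrease _ (hr (t + k)).1 _ h1 _ (hr (t + k)).2
  rw [hdyn k, h2]
  rw [add_assoc] at h
  linarith

lemma predict_eq (hdyn : ∀ k, (z (k + 1)).1 = f (z k).1 (z k).2) (k : ℕ) :
    predict f (z 0).1 (fun i => (z i).2) k = (z k).1 := by
  induction k with
  | zero => rfl
  | succ k ih => rw [predict, ih, hdyn]

/-! ### Bounds on the optimal cost -/

lemma le_cost {c : ℝ} (hQc : ∀ x, c * ‖x‖ ^ 2 ≤ quadNorm Q x) (hQ : Q.PosSemidef)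
    (hR : R.PosSemidef) (hN : 1 ≤ N) (hT : RobustTerminal f L Zr Q R N D T what)
    (hr : IsReference f Zr r) (x : State n) (u : ℕ → Input m) :
    c * ‖x - (r t).1‖ ^ 2 ≤ stageCost Q R x (u 0) (r t) ∧
      stageCost Q R x (u 0) (r t) ≤ cost f Q R N T r t x u := by
  constructor
  · have := hQc (x - (r t).1)
    have := quadNorm_nonneg hR (u 0 - (r t).2)
    simp only [stageCost]
    linarith
  · have h1 := Finset.single_le_sum (s := Finset.range N)
      (f := fun k => stageCost Q R (predict f x u k) (u k) (r (t + k)))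
      (fun k _ => stageCost_nonneg hQ hR _ _ _) (Finset.mem_range.2 hN)
    have h2 : 0 ≤ T.Vf (predict f x u N) (r (t + N)) := hT.quadNorm_P_nonneg (hr _).1 _
    simp only [predict, add_zero] at h1
    simp only [cost]
    linarith

/-- Inside the terminal set, the terminal controller is feasible and costs at most `V_f`. -/
lemma IsOptimal.cost_le_Vf (hD : IncrementallyStabilizable f L D)
    (hT : RobustTerminal f L Zr Q R N D T what) (hw : 0 ≤ what) (hr : IsReference f Zr r)
    {x : State n} {u : ℕ → Input m} (hu : IsOptimal f L Q R N D T what r t x u)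
    (hx : x ∈ T.Xf (r t)) : cost f Q R N T r t x u ≤ T.Vf x (r t) := by
  obtain ⟨z, -, hz0, hdyn, hz⟩ := exists_terminal_extension (u := u) (M := 0) (t := t) hT hw
    hD.rho_mem.1.le hr hx
  have hp : ∀ k, predict f x (fun i => (z i).2) k = (z k).1 := by
    have h0 : (z 0).1 = x := hz0
    intro k
    rw [← h0]
    exact predict_eq hdyn k
  have hsum : ∀ k, (∑ i ∈ Finset.range k, stageCost Q R (z i).1 (z i).2 (r (t + i))) +
      T.Vf (z k).1 (r (t + k)) ≤ T.Vf x (r t) := by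
    intro k
    induction k with
    | zero => simp [hz0, predict]
    | succ k ih =>
      rw [Finset.sum_range_succ]
      linarith [terminal_decrease hT hr hdyn hz (Nat.zero_le k)]
  refine (hu.2 (fun i => (z i).2) ⟨fun k hk => ?_, ?_⟩).trans ?_
  · rw [hp]
    exact tightenedSet_anti hD hw hk.le (terminal_mem_tightenedSet hT hr hz (Nat.zero_le k))
  · rw [hp]
    exact (hz N (Nat.zero_le N)).1
  · simp only [cost, hp]
    exact hsum N

/-- Every feasible cost is bounded by a constant because `Z` is bounded. -/
lemma FeasibleInput.cost_le (hD : IncrementallyStabilizable f L D) (hZr : Zr ⊆ constraintSet L)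
    {b cQ cR : ℝ} (hb : ∀ z ∈ constraintSet L, ‖z‖ ≤ b) (hcQ : 0 ≤ cQ) (hcR : 0 ≤ cR)
    (hQ : ∀ x, quadNorm Q x ≤ cQ * ‖x‖ ^ 2) (hR : ∀ x, quadNorm R x ≤ cR * ‖x‖ ^ 2)
    (hw : 0 ≤ what) (hr : IsReference f Zr r) {x : State n} {u : ℕ → Input m}
    (hu : FeasibleInput f L N D T what r t x u) :
    cost f Q R N T r t x u ≤ N * ((cQ + cR) * (2 * b) ^ 2) + T.alpha := by
  refine add_le_add ?_ hu.2
  have h : ∀ k ∈ Finset.range N, stageCost Q R (predict f x u k) (u k) (r (t + k)) ≤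
      (cQ + cR) * (2 * b) ^ 2 := by
    intro k hk
    refine stageCost_le (z := (predict f x u k, u k)) hcQ hcR hQ hR ?_
    have h1 := hb _ (tightenedSet_subset hD hw k (hu.1 k (Finset.mem_range.1 hk)))
    have h2 := hb _ (hZr (hr (t + k)).1)
    linarith [norm_sub_le (predict f x u k, u k) (r (t + k))]
  simpa using Finset.sum_le_card_nsmul _ _ _ h

lemma IsOptimal.cost_le (hD : IncrementallyStabilizable f L D) (hZr : Zr ⊆ constraintSet L)
    {b cQ cR : ℝ} (hb : ∀ z ∈ constraintSet L, ‖z‖ ≤ b) (hcQ : 0 ≤ cQ) (hcR : 0 ≤ cR)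
    (hQ : ∀ x, quadNorm Q x ≤ cQ * ‖x‖ ^ 2) (hR : ∀ x, quadNorm R x ≤ cR * ‖x‖ ^ 2)
    (hT : RobustTerminal f L Zr Q R N D T what) (hw : 0 ≤ what) (hr : IsReference f Zr r)
    {x : State n} {u : ℕ → Input m} (hu : IsOptimal f L Q R N D T what r t x u) :
    cost f Q R N T r t x u ≤
      (T.cu + (N * ((cQ + cR) * (2 * b) ^ 2) + T.alpha) * (T.cu / T.alpha)) *
        ‖x - (r t).1‖ ^ 2 := by
  have hα := hT.alpha_pos
  have hcu := hT.cu_pos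
  have hV : T.Vf x (r t) ≤ T.cu * ‖x - (r t).1‖ ^ 2 :=
    quadNorm_le_mul_sq_norm (hT.P_upper _ (hr t).1) _
  have hJ : 0 ≤ N * ((cQ + cR) * (2 * b) ^ 2) + T.alpha := by positivity
  rw [add_mul]
  by_cases hx : x ∈ T.Xf (r t)
  · have h := hu.cost_le_Vf hD hT hw hr hx
    have : 0 ≤ (N * ((cQ + cR) * (2 * b) ^ 2) + T.alpha) * (T.cu / T.alpha) *
        ‖x - (r t).1‖ ^ 2 := by positivity
    linarith
  · have hx' : T.alpha < T.Vf x (r t) := not_le.1 hx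
    have h1 : 1 ≤ T.cu / T.alpha * ‖x - (r t).1‖ ^ 2 := by
      rw [div_mul_eq_mul_div, le_div_iff₀ hα]
      linarith
    have h2 := hu.1.cost_le hD hZr hb hcQ hcR hQ hR hw hr
    have h3 := le_mul_of_one_le_right hJ h1
    have h4 : 0 ≤ T.cu * ‖x - (r t).1‖ ^ 2 := by positivity
    rw [mul_assoc]
    linarith

/-! ### The candidate input at the next time step -/

/-- Recursive feasibility and cost decrease. The candidate follows, with the incremental
controller, the previous prediction extended by the terminal controller. One tightening step
absorbs the resulting deviation in the constraints, and Young's inequality with parameter `η`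
separates its cost, quadratic in `ŵ`, from the nominal cost. -/
lemma exists_candidate (hD : IncrementallyStabilizable f L D) {b cQ cR cs : ℝ}
    (hb : ∀ z ∈ constraintSet L, ‖z‖ ≤ b) (hcQ : 0 ≤ cQ) (hcR : 0 ≤ cR)
    (hQ : ∀ x, quadNorm Q x ≤ cQ * ‖x‖ ^ 2) (hR : ∀ x, quadNorm R x ≤ cR * ‖x‖ ^ 2)
    (hcs0 : 0 ≤ cs) (hcs : ∀ j, D.c j ≤ cs) (hQ0 : Q.PosSemidef) (hR0 : R.PosSemidef)
    (hN : 1 ≤ N) (hT : RobustTerminal f L Zr Q R N D T what) (hw : 0 ≤ what)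
    (hwd : what ≤ √(D.deltaLoc / D.cu)) (hr : IsReference f Zr r) {x : State n}
    {u : ℕ → Input m} (hu : FeasibleInput f L N D T what r t x u) {w : State n}
    (hw' : ‖w‖ ≤ what) :
    ∃ v, FeasibleInput f L N D T what r (t + 1) (f x (u 0) + w) v ∧ ∀ η > 0,
      cost f Q R N T r (t + 1) (f x (u 0) + w) v ≤
        (1 + η) * (cost f Q R N T r t x u - stageCost Q R x (u 0) (r t)) +
        (1 + η⁻¹) * ((N * ((cQ + cR) * (b * (cs * √D.cu)) ^ 2) + T.cu * (D.cu / D.cl)) *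
          what ^ 2) := by
  have hcu := hD.cu_pos
  have hcl := hD.cl_pos
  have hTcu := hT.cu_pos
  obtain ⟨hρ0, hρ1⟩ := hD.rho_mem
  have hρk : ∀ k, D.rho ^ k ≤ 1 := fun k => pow_le_one₀ hρ0.le hρ1.le
  obtain ⟨z, hz1, hzN, hdyn, hzT⟩ := exists_terminal_extension hT hw hρ0.le hr hu.2
  have hzt : ∀ k ≤ N, z k ∈ tightenedSet L D what k := by
    intro k hk
    obtain hlt | rfl := hk.lt_or_eq
    · rw [hz1 k hlt]
      exact hu.1 k hlt
    · exact terminal_mem_tightenedSet hT hr hzT le_rfl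
  have hzZ : ∀ k, z k ∈ constraintSet L := by
    intro k
    obtain hk | hk := le_total k N
    · exact tightenedSet_subset hD hw k (hzt k hk)
    · exact tightenedSet_subset hD hw N (terminal_mem_tightenedSet hT hr hzT hk)
  have hz0 : z 0 = (x, u 0) := hz1 0 hN
  have hx : ‖f x (u 0) + w - (z (0 + 1)).1‖ ≤ what := by
    rw [hdyn 0, hz0, add_sub_cancel_left]
    exact hw'
  obtain ⟨v, hv⟩ := exists_tracking_input (z := fun k => z (k + 1)) hD hw hwd
    (fun k => hzZ _) (fun k => hdyn _) hx
  set y := predict f (f x (u 0) + w) v with hy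
  have ht : ∀ k, r (t + 1 + k) = r (t + (k + 1)) := fun k => by congr 1; omega
  refine ⟨v, ⟨fun k hk j => ?_, ?_⟩, fun η hη => ?_⟩
  · have h1 := hzt (k + 1) hk j
    have h2 := (hv k).1 j
    rw [map_sub] at h2
    rw [tightening_succ hD] at h1
    linarith
  · have h := hT.rpi _ (hr (t + N)).1 _ (hzT N le_rfl).1 _ (hr (t + N)).2 (y N - (z (N + 1)).1)
      ((hv N).2.trans_eq rfl)
    rw [← (hzT N le_rfl).2, ← hdyn N, add_sub_cancel] at h
    rw [ht N]
    exact h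
  · have hη' : 0 < η⁻¹ := inv_pos.2 hη
    have hstage : ∀ k, stageCost Q R (y k) (v k) (r (t + 1 + k)) ≤
        (1 + η) * stageCost Q R (z (k + 1)).1 (z (k + 1)).2 (r (t + (k + 1))) +
        (1 + η⁻¹) * ((cQ + cR) * (b * (cs * √D.cu)) ^ 2 * what ^ 2) := by
      intro k
      have hdiff : ‖(y k, v k) - z (k + 1)‖ ≤ b * (cs * √D.cu * what) := by
        refine norm_le_of_forall_le hb (by positivity) fun j => ((hv k).1 j).trans ?_
        rw [mul_assoc]
        exact mul_le_mul (hcs j) (mul_le_of_le_one_left (by positivity) (hρk k)) (by positivity)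
          hcs0
      have h1 := stageCost_le (z := (y k, v k)) hcQ hcR hQ hR hdiff
      have h2 := stageCost_le_of_near hQ0 hR0 hη (y k, v k) (z (k + 1)) (r (t + (k + 1)))
      rw [ht k]
      refine h2.trans (add_le_add le_rfl (mul_le_mul_of_nonneg_left (h1.trans_eq ?_) ?_))
      · ring
      · positivity
    have hterm : T.Vf (y N) (r (t + 1 + N)) ≤
        (1 + η) * T.Vf (z (N + 1)).1 (r (t + (N + 1))) +
        (1 + η⁻¹) * (T.cu * (D.cu / D.cl) * what ^ 2) := by
      have hd : ‖y N - (z (N + 1)).1‖ ≤ what * √(D.cu / D.cl) := by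
        refine (hv N).2.trans ?_
        gcongr
        exact mul_le_of_le_one_right hw (hρk N)
      have h1 : quadNorm (T.P (r (t + (N + 1)))) (y N - (z (N + 1)).1) ≤
          T.cu * (D.cu / D.cl) * what ^ 2 := by
        refine (quadNorm_le_mul_sq_norm (hT.P_upper _ (hr _).1) _).trans ?_
        have h := pow_le_pow_left₀ (norm_nonneg _) hd 2
        rw [mul_pow, Real.sq_sqrt (by positivity)] at h
        rw [mul_assoc, mul_comm (D.cu / D.cl)]
        gcongr
      have h2 := quadNorm_add_le (fun a => hT.quadNorm_P_nonneg (hr (t + (N + 1))).1 a) hη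
        ((z (N + 1)).1 - (r (t + (N + 1))).1) (y N - (z (N + 1)).1)
      rw [show (z (N + 1)).1 - (r (t + (N + 1))).1 + (y N - (z (N + 1)).1) =
        y N - (r (t + (N + 1))).1 by abel] at h2
      rw [ht N]
      refine h2.trans (add_le_add le_rfl (mul_le_mul_of_nonneg_left h1 ?_))
      positivity
    -- The shifted nominal trajectory costs at most the previous cost minus its first stage.
    have hnom : (∑ k ∈ Finset.range N,
          stageCost Q R (z (k + 1)).1 (z (k + 1)).2 (r (t + (k + 1)))) +
        T.Vf (z (N + 1)).1 (r (t + (N + 1))) ≤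
        cost f Q R N T r t x u - stageCost Q R x (u 0) (r t) := by
      have hs := Finset.sum_range_succ' (fun k => stageCost Q R (z k).1 (z k).2 (r (t + k))) N
      rw [Finset.sum_range_succ] at hs
      have hc : cost f Q R N T r t x u =
          (∑ k ∈ Finset.range N, stageCost Q R (z k).1 (z k).2 (r (t + k))) +
            T.Vf (z N).1 (r (t + N)) := by
        rw [cost, hzN]
        congr 1
        refine Finset.sum_congr rfl fun k hk => ?_
        rw [hz1 k (Finset.mem_range.1 hk)]
      rw [hz0, add_zero] at hs
      linarith [terminal_decrease hT hr hdyn hzT le_rfl]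
    have hsum := Finset.sum_le_sum fun k (_ : k ∈ Finset.range N) => hstage k
    rw [Finset.sum_add_distrib, ← Finset.mul_sum, Finset.sum_const, Finset.card_range,
      nsmul_eq_mul] at hsum
    have hη1 := mul_le_mul_of_nonneg_left hnom (by positivity : 0 ≤ 1 + η)
    rw [show cost f Q R N T r (t + 1) (f x (u 0) + w) v =
      (∑ k ∈ Finset.range N, stageCost Q R (y k) (v k) (r (t + 1 + k))) +
        T.Vf (y N) (r (t + 1 + N)) from rfl]
    linarith

end Terminal

/-! ### Exponential decay from the cost recursion -/

lemma le_of_recursion {J : ℕ → ℝ} {μ c : ℝ} (hμ0 : 0 ≤ μ) (hμ1 : μ < 1) (hc : 0 ≤ c)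
    (h : ∀ t, J (t + 1) ≤ μ * J t + c) (t k : ℕ) : J (t + k) ≤ μ ^ k * J t + c / (1 - μ) := by
  have h1 : 0 < 1 - μ := by linarith
  induction k with
  | zero =>
    have : 0 ≤ c / (1 - μ) := by positivity
    simpa using this
  | succ k ih =>
    calc J (t + (k + 1)) ≤ μ * J (t + k) + c := h (t + k)
      _ ≤ μ * (μ ^ k * J t + c / (1 - μ)) + c := by gcongr
      _ = μ ^ (k + 1) * J t + c / (1 - μ) := by field_simp; ring

end RobustMPC

open RobustMPC

theorem theorem2 {n m q : ℕ} (f : State n → Input m → State n)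
    (L : Fin q → Pair n m →ₗ[ℝ] ℝ) (hZ : IsCompact (constraintSet L))
    (Zr : Set (Pair n m)) (hZr : Zr ⊆ interior (constraintSet L))
    (Q : Matrix (Fin n) (Fin n) ℝ) (hQ : Q.PosDef)
    (R : Matrix (Fin m) (Fin m) ℝ) (hR : R.PosDef)
    (N : ℕ) (hN : 1 ≤ N)
    (D : IncrementalData n m q) (hD : IncrementallyStabilizable f L D)
    (T : TerminalData n m) :
    ∃ C lam gam : ℝ, 0 < C ∧ 0 < lam ∧ lam < 1 ∧ 0 ≤ gam ∧
      ∀ what : ℝ, 0 ≤ what → what ≤ √(D.deltaLoc / D.cu) →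
        RobustTerminal f L Zr Q R N D T what →
        ∀ r : ℕ → Pair n m, IsReference f Zr r →
        ∀ (x : ℕ → State n) (ustar : ℕ → ℕ → Input m) (w : ℕ → State n),
          ClosedLoop f L Q R N D T what r x ustar w →
          Feasible f L N D T what r 0 (x 0) →
          (∀ t, Feasible f L N D T what r t (x t)) ∧
          ∀ t k, ‖x (t + k) - (r (t + k)).1‖ ≤
            C * lam ^ k * ‖x t - (r t).1‖ + gam * what := by
  -- If no `ŵ` admits the terminal ingredients, `T` need not have positive constants, and there
  -- is nothing to prove.
  by_cases hex : ∃ what, RobustTerminal f L Zr Q R N D T what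
  swap
  · exact ⟨1, 1 / 2, 0, by norm_num, by norm_num, by norm_num, le_rfl,
      fun what _ _ hT => absurd ⟨what, hT⟩ hex⟩
  obtain ⟨hTcu, hα⟩ : 0 < T.cu ∧ 0 < T.alpha := by
    obtain ⟨_, hT⟩ := hex
    exact ⟨hT.cu_pos, hT.alpha_pos⟩
  have hcu := hD.cu_pos
  have hcl := hD.cl_pos
  have hZr' : Zr ⊆ constraintSet L := hZr.trans interior_subset
  obtain ⟨b, -, hb⟩ := hZ.isBounded.exists_pos_norm_le
  obtain ⟨cQ, hcQ0, hcQ⟩ := exists_quadNorm_le Q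
  obtain ⟨cR, hcR0, hcR⟩ := exists_quadNorm_le R
  obtain ⟨p, hp0, hp⟩ := exists_le_quadNorm hQ
  have hcs0 : 0 ≤ ∑ j, D.c j := Finset.sum_nonneg fun j _ => (hD.c_pos j).le
  have hcs : ∀ j, D.c j ≤ ∑ j, D.c j := fun j =>
    Finset.single_le_sum (f := D.c) (fun i _ => (hD.c_pos i).le) (Finset.mem_univ j)
  set a : ℝ := T.cu + (N * ((cQ + cR) * (2 * b) ^ 2) + T.alpha) * (T.cu / T.alpha) with ha
  set K : ℝ := N * ((cQ + cR) * (b * ((∑ j, D.c j) * √D.cu)) ^ 2) + T.cu * (D.cu / D.cl) with hK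
  have ha0 : 0 < a := by positivity
  have hK0 : 0 ≤ K := by positivity
  -- The relative decrease `θ` of the optimal cost also serves as Young parameter, which yields the
  -- contraction factor `(1 + θ) (1 - θ) = 1 - θ²`. The summand `p` in the denominator keeps
  -- `θ < 1`.
  set θ : ℝ := p / (p + a) with hθ
  have hθ0 : 0 < θ := by positivity
  have hθ1 : θ < 1 := by rw [hθ, div_lt_one (by positivity)]; linarith
  have hμ0 : 0 < 1 - θ ^ 2 := by nlinarith
  have hμ1 : 1 - θ ^ 2 < 1 := by nlinarith
  set G : ℝ := (1 + θ⁻¹) * K / (1 - (1 - θ ^ 2)) with hG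
  have hG0 : 0 ≤ G := by
    have : 0 < 1 - (1 - θ ^ 2) := by linarith
    positivity
  refine ⟨√(a / p), √(1 - θ ^ 2), √(G / p), by positivity, by positivity,
    (Real.sqrt_lt' one_pos).2 (by linarith), by positivity, ?_⟩
  intro what hw hwd hT r hr x ustar w hcl' hfeas0
  have hfeas : ∀ t, Feasible f L N D T what r t (x t) := by
    intro t
    induction t with
    | zero => exact hfeas0
    | succ t ih =>
      obtain ⟨hwt, hopt, hstep⟩ := hcl' t
      obtain ⟨v, hv, -⟩ := exists_candidate hD hb hcQ0 hcR0 hcQ hcR hcs0 hcs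
        hQ.posSemidef hR.posSemidef hN hT hw hwd hr (hopt ih).1 hwt
      rw [hstep]
      exact ⟨v, hv⟩
  refine ⟨hfeas, fun t k => ?_⟩
  have hopt : ∀ t, IsOptimal f L Q R N D T what r t (x t) (ustar t) :=
    fun t => (hcl' t).2.1 (hfeas t)
  have hlow := fun t => le_cost (t := t) hp hQ.posSemidef hR.posSemidef hN hT hr (x t) (ustar t)
  have hup := fun t => (hopt t).cost_le hD hZr' hb hcQ0 hcR0 hcQ hcR hT hw hr
  rw [← ha] at hup
  set J : ℕ → ℝ := fun t => cost f Q R N T r t (x t) (ustar t) with hJ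
  have hrec : ∀ t, J (t + 1) ≤ (1 - θ ^ 2) * J t + (1 + θ⁻¹) * K * what ^ 2 := by
    intro t
    obtain ⟨hwt, -, hstep⟩ := hcl' t
    obtain ⟨v, hv, hvc⟩ := exists_candidate hD hb hcQ0 hcR0 hcQ hcR hcs0 hcs
      hQ.posSemidef hR.posSemidef hN hT hw hwd hr (hopt t).1 hwt
    rw [← hstep] at hv hvc
    have h1 : J (t + 1) ≤ _ := ((hopt (t + 1)).2 v hv).trans (hvc θ hθ0)
    have h2 : θ * J t ≤ stageCost Q R (x t) (ustar t 0) (r t) := by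
      refine le_trans ?_ (hlow t).1
      have h3 : J t ≤ (p + a) * ‖x t - (r t).1‖ ^ 2 := by
        refine (hup t).trans ?_
        gcongr
        linarith
      calc θ * J t ≤ θ * ((p + a) * ‖x t - (r t).1‖ ^ 2) := by gcongr
        _ = p * ‖x t - (r t).1‖ ^ 2 := by rw [hθ]; field_simp
    calc J (t + 1) ≤ _ := h1
      _ ≤ (1 + θ) * (J t - θ * J t) + (1 + θ⁻¹) * (K * what ^ 2) := by gcongr
      _ = _ := by ring
  have hgeo := le_of_recursion hμ0.le hμ1 (by positivity) hrec t k
  have hsq : p * ‖x (t + k) - (r (t + k)).1‖ ^ 2 ≤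
      (1 - θ ^ 2) ^ k * (a * ‖x t - (r t).1‖ ^ 2) + G * what ^ 2 := by
    calc _ ≤ J (t + k) := (hlow _).1.trans (hlow _).2
      _ ≤ _ := hgeo
      _ ≤ (1 - θ ^ 2) ^ k * (a * ‖x t - (r t).1‖ ^ 2) +
          (1 + θ⁻¹) * K * what ^ 2 / (1 - (1 - θ ^ 2)) := by gcongr; exact hup t
      _ = _ := by rw [hG]; ring
  set A : ℝ := √(a / p) * √(1 - θ ^ 2) ^ k * ‖x t - (r t).1‖ with hA
  set B : ℝ := √(G / p) * what with hB
  have hA0 : 0 ≤ A := by positivity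
  have hB0 : 0 ≤ B := by positivity
  have hA2 : p * A ^ 2 = (1 - θ ^ 2) ^ k * (a * ‖x t - (r t).1‖ ^ 2) := by
    rw [hA, mul_pow, mul_pow, ← pow_mul, mul_comm k, pow_mul, Real.sq_sqrt (by positivity),
      Real.sq_sqrt hμ0.le]
    field_simp
  have hB2 : p * B ^ 2 = G * what ^ 2 := by
    rw [hB, mul_pow, Real.sq_sqrt (by positivity)]
    field_simp
  refine abs_le_of_sq_le_sq' ?_ (by positivity) |>.2
  refine le_of_mul_le_mul_left ?_ hp0
  calc _ ≤ p * A ^ 2 + p * B ^ 2 := by rw [hA2, hB2]; exact hsq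
    _ ≤ p * (A + B) ^ 2 := by nlinarith [mul_nonneg hp0.le (mul_nonneg hA0 hB0)]
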